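/- **Theorem 4.** A complex polynomial is called Hurwitz stable if all its roots lie in the open left half-plane (so the zero polynomial is not Hurwitz stable). For $\ast\in\{u,v\}$ let $n_\ast\ge 0$ be an integer, let $\alpha_i^{\ast-}\le\alpha_i^{\ast+}$ and $\beta_i^{\ast-}\le\beta_i^{\ast+}$ ($0\le i\le n_\ast$) be real numbers, and let $$\Delta_\ast=\Big\{\sum_{i=0}^{n_\ast}(\alpha_i+\mathrm{j}\beta_i)s^i \;:\; \alpha_i\in[\alpha_i^{\ast-},\alpha_i^{\ast+}],\ \beta_i\in[\beta_i^{\ast-},\beta_i^{\ast+}],\ 0\le i\le n_\ast\Big\},\qquad \mathrm{j}=\sqrt{-1}.$$ The eight Kharitonov polynomials $K_1^{\pm\ast},\dots,K_4^{\pm\ast}$ of $\Delta_\ast$ are the members of $\Delta_\ast$ whose $i$-th coefficient is $\alpha_i^{\ast\sigma}+\mathrm{j}\,\beta_i^{\ast\tau}$, where the signs $(\sigma,\tau)$ depend only on $i \bmod 4$ and are, for $i\equiv 0,1,2,3 \pmod 4$ in this order, $$\begin{array}{ll} K_1^{+}:\ (-,-),(-,+),(+,+),(+,-) & \quad K_1^{-}:\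 (-,-),(+,-),(+,+),(-,+)\\ K_2^{+}:\ (-,+),(+,+),(+,-),(-,-) & \quad K_2^{-}:\ (-,+),(-,-),(+,-),(+,+)\\ K_3^{+}:\ (+,-),(-,-),(-,+),(+,+) & \quad K_3^{-}:\ (+,-),(+,+),(-,+),(-,-)\\ K_4^{+}:\ (+,+),(+,-),(-,-),(-,+) & \quad K_4^{-}:\ (+,+),(-,+),(-,-),(+,-) \end{array}$$ Let $\gamma_{ij},\eta_{ij}$ ($1\le i,j\le n$) be complex numbers and put $M(\delta_u,\delta_v)=[\gamma_{ij}\delta_u(s)+\eta_{ij}\delta_v(s)]_{n\times n}$. Suppose that the polynomial family $\{\det M(\delta_u,\delta_v) : \delta_u\in\Delta_u,\ \delta_v\in\Delta_v\}$ has a fixed order, i.e. all its members have the same degree (the zero polynomial having degree $-\infty$). Then $\det M(\delta_u,\delta_v)$ is Hurwitz stable for all $\delta_u\in\Delta_u$ and $\delta_v\in\Delta_v$ if and only if the $32$ polynomials $$\det M(K_i^{+u},K_j^{+v}),\qquad \det M(K_i^{-u},K_j^{-v}),\qquad i,j=1,2,3,4,$$ are all Hurwitz stable. -/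

import Mathlib

open Polynomial

/-- A complex polynomial is Hurwitz stable if all its roots lie in the open left half-plane.
Every complex number is a root of the zero polynomial, so the zero polynomial is not stable. -/
def IsHurwitz (p : ℂ[X]) : Prop := ∀ z : ℂ, p.IsRoot z → z.re < 0

/-- The data of a complex interval polynomial family of order `order`: for every `i ≤ order`, an
interval `[reLo i, reHi i]` for the real part and an interval `[imLo i, imHi i]` for the imaginary
part of the `i`-th coefficient. Values at indices above `order` are never used. -/
structure ComplexInterval where
  order : ℕ
  reLo : ℕ → ℝ
  reHi : ℕ → ℝ
  imLo : ℕ → ℝ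
  imHi : ℕ → ℝ
  re_le : ∀ i ≤ order, reLo i ≤ reHi i
  im_le : ∀ i ≤ order, imLo i ≤ imHi i

namespace ComplexInterval

/-- The family of all polynomials `∑ i ≤ order, (α i + j β i) s ^ i` with `α i` and `β i` in the
prescribed intervals. -/
def family (D : ComplexInterval) : Set ℂ[X] :=
  {p | ∃ α β : ℕ → ℝ,
    (∀ i ≤ D.order, α i ∈ Set.Icc (D.reLo i) (D.reHi i)) ∧
    (∀ i ≤ D.order, β i ∈ Set.Icc (D.imLo i) (D.imHi i)) ∧
    p = ∑ i ∈ Finset.range (D.order + 1), C (⟨α i, β i⟩ : ℂ) * X ^ i}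

/-- The vertex polynomial whose choice of endpoints has period four in the index of the
coefficient: `true` selects the upper endpoint and `false` the lower one, `a` for the real parts and
`b` for the imaginary parts. -/
noncomputable def vertex (D : ComplexInterval) (a b : Fin 4 → Bool) : ℂ[X] :=
  ∑ i ∈ Finset.range (D.order + 1),
    C (⟨if a (Fin.ofNat 4 i) then D.reHi i else D.reLo i,
        if b (Fin.ofNat 4 i) then D.imHi i else D.imLo i⟩ : ℂ) * X ^ i

/-- The Kharitonov polynomials `K₁⁺, K₂⁺, K₃⁺, K₄⁺` (indexed from `0`). -/
noncomputable def kPlus (D : ComplexInterval) : Fin 4 → ℂ[X] :=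
  ![D.vertex ![false, false, true, true] ![false, true, true, false],
    D.vertex ![false, true, true, false] ![true, true, false, false],
    D.vertex ![true, false, false, true] ![false, false, true, true],
    D.vertex ![true, true, false, false] ![true, false, false, true]]

/-- The Kharitonov polynomials `K₁⁻, K₂⁻, K₃⁻, K₄⁻` (indexed from `0`). -/
noncomputable def kMinus (D : ComplexInterval) : Fin 4 → ℂ[X] :=
  ![D.vertex ![false, true, true, false] ![false, false, true, true],
    D.vertex ![false, false, true, true] ![true, false, false, true],
    D.vertex ![true, true, false, false] ![false, true, true, false],
    D.vertex ![true, false, false, true] ![true, true, false, false]]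

end ComplexInterval

/-- The polynomial matrix `[γ i j * u + η i j * v]`. -/
noncomputable def polyMatrix {n : ℕ} (γ η : Matrix (Fin n) (Fin n) ℂ) (u v : ℂ[X]) :
    Matrix (Fin n) (Fin n) ℂ[X] :=
  Matrix.of fun i j => C (γ i j) * u + C (η i j) * v

/-- All determinants of the matrix family, for `u` and `v` ranging over the two interval
families. -/
def detFamily {n : ℕ} (γ η : Matrix (Fin n) (Fin n) ℂ) (Du Dv : ComplexInterval) : Set ℂ[X] :=
  {p | ∃ u ∈ Du.family, ∃ v ∈ Dv.family, p = (polyMatrix γ η u v).det}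

/-- A polynomial family has a fixed order if all its members have the same degree (the zero
polynomial has degree `⊥`). -/
def HasFixedOrder (S : Set ℂ[X]) : Prop := ∃ d : WithBot ℕ, ∀ p ∈ S, p.degree = d

/-! The determinant of `x • γ + y • η` is a binary form over `ℂ`, so `det M` is a constant times a
product of linear combinations `a * u + b * v` (`exists_det_polyMatrix_eq_prod`). Factors of a
Hurwitz polynomial are Hurwitz, and a fixed order of the product forces a fixed degree of each
factor (`natDegree_factor_le_of_natDegree_prod_eq`). It thus suffices to treat one combination `a *
u + b * v`.

On each half of the imaginary axis, the values of an interval family lie in a rectangle cornered by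
the values of four Kharitonov polynomials. The values of `a * u + b * v` therefore lie in a zonotope
whose edges keep the directions `a`, `ja`, `b`, `jb`, while only their lengths vary with the
frequency. If the zonotope met the origin, then at the last such frequency the origin would lie on
its boundary, hence on a face whose two extreme vertices have values on opposite sides of the
origin. The difference of these two vertex polynomials keeps the direction of the face at every
frequency, so both values cross the line of the face with the same normal velocity. Increasing phase
demands opposite signs (`IsHurwitz.not_opposite`), a contradiction. With the axis free of roots and
the degree constant, stability spreads from one vertex along segments (`IsHurwitz.of_segment`). -/

/-! ### Phase, growth and root location of Hurwitz polynomials. -/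

open ComplexConjugate in
/-- The argument of a nonconstant Hurwitz polynomial strictly increases along the imaginary axis:
the real part of its logarithmic derivative is positive there. -/
theorem IsHurwitz.re_derivative_mul_conj_pos {p : ℂ[X]} (hp : IsHurwitz p)
    (hd : 0 < p.natDegree) {z : ℂ} (hz : 0 ≤ z.re) :
    0 < (p.derivative.eval z * conj (p.eval z)).re := by
  have hz0 : p.eval z ≠ 0 := fun h => absurd (hp z h) (not_lt.2 hz)
  have hlog := (IsAlgClosed.splits p).eval_derivative_div_eval_of_ne_zero hz0
  have hroots : p.roots ≠ 0 := by
    rw [← Multiset.card_pos, ← (IsAlgClosed.splits p).natDegree_eq_card_roots]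
    exact hd
  -- `p' / p` is the sum of `1 / (z - r)` over the roots, and inversion preserves the open right
  -- half-plane that contains each `z - r`.
  have hpos : 0 < (p.derivative.eval z / p.eval z).re := by
    have key : ∀ s : Multiset ℂ, (∀ r ∈ s, r.re < 0) → s ≠ 0 →
        0 < ((s.map fun r => 1 / (z - r)).sum).re := by
      intro s
      induction s using Multiset.induction_on with
      | empty => simp
      | cons r s ih =>
        intro hs _
        have hr : 0 < (1 / (z - r)).re := by
          have h1 : 0 < (z - r).re := by
            have := hs r (Multiset.mem_cons_self r s)
            simp only [Complex.sub_re]; linarith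
          have h2 : z - r ≠ 0 := fun h => by simp [h] at h1
          rw [one_div, Complex.inv_re]
          exact div_pos h1 (Complex.normSq_pos.2 h2)
        rw [Multiset.map_cons, Multiset.sum_cons, Complex.add_re]
        rcases eq_or_ne s 0 with rfl | hne
        · simpa using hr
        · exact add_pos hr (ih (fun r hr => hs r (Multiset.mem_cons_of_mem hr)) hne)
    rw [hlog]
    exact key _ (fun r hr => hp r (isRoot_of_mem_roots hr)) hroots
  have heq : p.derivative.eval z * conj (p.eval z) =
      (p.derivative.eval z / p.eval z) * (Complex.normSq (p.eval z) : ℂ) := by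
    rw [Complex.normSq_eq_conj_mul_self]
    field_simp
  rw [heq, Complex.re_mul_ofReal]
  exact mul_pos hpos (Complex.normSq_pos.2 hz0)

/-- Each root is at distance at least `s.re` from `s`. Unlike stability itself, the resulting
inequality is a closed condition on the coefficients, yet with a nonzero leading coefficient it
still excludes roots with positive real part. -/
theorem IsHurwitz.norm_leadingCoeff_mul_re_pow_le {p : ℂ[X]} (hp : IsHurwitz p) {s : ℂ}
    (hs : 0 ≤ s.re) : ‖p.leadingCoeff‖ * s.re ^ p.natDegree ≤ ‖p.eval s‖ := by
  have key : ∀ m : Multiset ℂ, (∀ r ∈ m, r.re < 0) →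
      s.re ^ m.card ≤ ‖(m.map fun r => s - r).prod‖ := by
    intro m
    induction m using Multiset.induction_on with
    | empty => simp
    | cons r m ih =>
      intro hm
      have hr : s.re ≤ ‖s - r‖ := by
        refine le_trans ?_ (Complex.re_le_norm _)
        have := hm r (Multiset.mem_cons_self r m)
        simp only [Complex.sub_re]; linarith
      rw [Multiset.card_cons, pow_succ', Multiset.map_cons, Multiset.prod_cons, norm_mul]
      exact mul_le_mul hr (ih fun r hr => hm r (Multiset.mem_cons_of_mem hr))
        (pow_nonneg hs _) (norm_nonneg _)
  rw [(IsAlgClosed.splits p).eval_eq_prod_roots, norm_mul,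
    (IsAlgClosed.splits p).natDegree_eq_card_roots]
  exact mul_le_mul_of_nonneg_left (key _ fun r hr => hp r (isRoot_of_mem_roots hr)) (norm_nonneg _)

/-- Constant degree keeps the leading coefficient away from zero on `K`, so Cauchy's root bound is
dominated by a function continuous on `K`. -/
theorem exists_bound_roots_of_isCompact {T : Type*} [TopologicalSpace T] {K : Set T}
    (hK : IsCompact K) {P : T → ℂ[X]} (hcont : ∀ i, Continuous fun t => (P t).coeff i) {d : ℕ}
    (hdeg : ∀ t ∈ K, (P t).degree = d) :
    ∃ R : ℝ, ∀ t ∈ K, ∀ z, (P t).IsRoot z → ‖z‖ ≤ R := by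
  have hne : ∀ t ∈ K, P t ≠ 0 := fun t ht h => by simpa [h] using hdeg t ht
  have hnat : ∀ t ∈ K, (P t).natDegree = d := fun t ht => natDegree_eq_of_degree_eq_some (hdeg t ht)
  have hlead : ∀ t ∈ K, ‖(P t).coeff d‖ ≠ 0 := by
    intro t ht h
    rw [norm_eq_zero, ← hnat t ht] at h
    exact hne t ht (leadingCoeff_eq_zero.1 h)
  have hF : ContinuousOn
      (fun t => (∑ i ∈ Finset.range d, ‖(P t).coeff i‖) / ‖(P t).coeff d‖ + 1) K := by
    refine ContinuousOn.add (ContinuousOn.div ?_ (hcont d).norm.continuousOn hlead)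
      continuousOn_const
    exact (continuous_finsetSum _ fun i _ => (hcont i).norm).continuousOn
  obtain ⟨R, hR⟩ := hK.bddAbove_image hF
  refine ⟨R, fun t ht z hz => ?_⟩
  have hle := hR (Set.mem_image_of_mem _ ht)
  refine le_trans ?_ hle
  refine le_trans (b := (cauchyBound (P t) : ℝ))
    (by exact_mod_cast (IsRoot.norm_lt_cauchyBound (hne t ht) hz).le) ?_
  have hsup : (Finset.range d).sup (fun i => ‖(P t).coeff i‖₊) ≤
      ∑ i ∈ Finset.range d, ‖(P t).coeff i‖₊ :=
    Finset.sup_le fun i hi => Finset.single_le_sum (f := fun i => ‖(P t).coeff i‖₊)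
      (fun _ _ => zero_le) hi
  simp only [cauchyBound, leadingCoeff, hnat t ht]
  push_cast
  gcongr
  have h := NNReal.coe_le_coe.2 hsup
  rwa [NNReal.coe_sum] at h

theorem continuous_coeff_add_C_mul (p q : ℂ[X]) (i : ℕ) :
    Continuous fun t : ℝ => (p + C (t : ℂ) * q).coeff i := by
  simp only [coeff_add, coeff_C_mul]
  fun_prop

/-- Along a segment of polynomials of constant degree without roots on the imaginary axis, Hurwitz
stability propagates from one end to the other. -/
theorem IsHurwitz.of_segment {p q : ℂ[X]} {d : ℕ}
    (hdeg : ∀ t ∈ Set.Icc (0 : ℝ) 1, (p + C (t : ℂ) * q).degree = d)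
    (haxis : ∀ t ∈ Set.Icc (0 : ℝ) 1, ∀ z : ℂ, z.re = 0 → ¬ (p + C (t : ℂ) * q).IsRoot z)
    (hp : IsHurwitz p) : IsHurwitz (p + q) := by
  obtain ⟨R, hR⟩ := exists_bound_roots_of_isCompact (isCompact_Icc (a := (0 : ℝ)) (b := 1))
    (continuous_coeff_add_C_mul p q) hdeg
  have heval : Continuous fun x : ℝ × ℂ => (p + C (x.1 : ℂ) * q).eval x.2 := by
    have h1 : Continuous fun x : ℝ × ℂ => p.eval x.2 := p.continuous.comp continuous_snd
    have h2 : Continuous fun x : ℝ × ℂ => q.eval x.2 := q.continuous.comp continuous_snd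
    simp only [eval_add, eval_mul, eval_C]
    fun_prop
  -- Unstable parameters lie in `bad` and stable ones in `good`. Both sets are closed, so
  -- connectedness of `[0, 1]` gives a common parameter; its root has real part zero, against
  -- `haxis`, or positive, against the growth bound.
  set bad : Set ℝ := Prod.fst '' ((Set.Icc (0 : ℝ) 1 ×ˢ Metric.closedBall (0 : ℂ) R) ∩
    {x : ℝ × ℂ | 0 ≤ x.2.re ∧ (p + C (x.1 : ℂ) * q).eval x.2 = 0}) with hbad
  set good : Set ℝ := {t | ∀ s : ℂ, 0 ≤ s.re →
    ‖(p + C (t : ℂ) * q).coeff d‖ * s.re ^ d ≤ ‖(p + C (t : ℂ) * q).eval s‖} with hgood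
  have hbadc : IsClosed bad := by
    refine IsCompact.isClosed (IsCompact.image ?_ continuous_fst)
    refine (isCompact_Icc.prod (isCompact_closedBall 0 R)).inter_right ?_
    exact (isClosed_le continuous_const (Complex.continuous_re.comp continuous_snd)).inter
      (isClosed_eq heval continuous_const)
  have hgoodc : IsClosed good := by
    have : good = ⋂ s : ℂ, ⋂ _ : 0 ≤ s.re, {t : ℝ |
        ‖(p + C (t : ℂ) * q).coeff d‖ * s.re ^ d ≤ ‖(p + C (t : ℂ) * q).eval s‖} := by
      ext t; simp [hgood]
    rw [this]
    refine isClosed_iInter fun s => isClosed_iInter fun _ => isClosed_le ?_ ?_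
    · exact (continuous_coeff_add_C_mul p q d).norm.mul continuous_const
    · exact (heval.comp (continuous_id.prodMk continuous_const)).norm
  have hmem : ∀ t ∈ Set.Icc (0 : ℝ) 1, IsHurwitz (p + C (t : ℂ) * q) → t ∈ good := by
    intro t ht h s hs
    have := h.norm_leadingCoeff_mul_re_pow_le hs
    rwa [leadingCoeff, natDegree_eq_of_degree_eq_some (hdeg t ht)] at this
  have hmem' : ∀ t ∈ Set.Icc (0 : ℝ) 1, ¬ IsHurwitz (p + C (t : ℂ) * q) → t ∈ bad := by
    intro t ht h
    simp only [IsHurwitz, not_forall, not_lt] at h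
    obtain ⟨z, hz, hz0⟩ := h
    exact ⟨(t, z), ⟨⟨ht, by simpa using hR t ht z hz⟩, hz0, hz⟩, rfl⟩
  by_contra hcon
  have h0 : (0 : ℝ) ∈ good := hmem 0 (by simp) (by simpa using hp)
  have h1 : (1 : ℝ) ∈ bad := hmem' 1 (by simp) (by simpa using hcon)
  obtain ⟨t, ht, htg, htb⟩ := (isPreconnected_closed_iff.1 isPreconnected_Icc) good bad hgoodc hbadc
    (fun t ht => by
      by_cases h : IsHurwitz (p + C (t : ℂ) * q)
      · exact Or.inl (hmem t ht h)
      · exact Or.inr (hmem' t ht h))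
    ⟨0, by simp, h0⟩ ⟨1, by simp, h1⟩
  obtain ⟨⟨t', z⟩, ⟨-, hz0, hz⟩, rfl⟩ := htb
  rcases hz0.eq_or_lt with hz1 | hz1
  · exact haxis t' ht z hz1.symm hz
  · have h := htg z hz0
    dsimp only at h hz
    rw [hz, norm_zero] at h
    have hl : (p + C (t' : ℂ) * q).coeff d ≠ 0 := coeff_ne_zero_of_eq_degree (hdeg t' ht)
    have := mul_pos (norm_pos_iff.2 hl) (pow_pos hz1 d)
    linarith

/-! ### Zero exclusion for zonotopes of polynomials. -/

/-- The point with coordinates `x` of the family spanned by the generators `τ` at `p₀`. -/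
noncomputable def zonotopePoly {ι : Type*} [Fintype ι] (p₀ : ℂ[X]) (τ : ι → ℂ[X])
    (x : ι → ℝ) : ℂ[X] :=
  p₀ + ∑ k, C (x k : ℂ) * τ k

section zonotopePoly

variable {ι : Type*} [Fintype ι] {p₀ : ℂ[X]} {τ : ι → ℂ[X]}

theorem eval_zonotopePoly (x : ι → ℝ) (z : ℂ) :
    (zonotopePoly p₀ τ x).eval z = p₀.eval z + ∑ k, (x k : ℂ) * (τ k).eval z := by
  simp [zonotopePoly, eval_finsetSum]

theorem eval_zonotopePoly_sub (x y : ι → ℝ) (z : ℂ) :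
    (zonotopePoly p₀ τ x).eval z - (zonotopePoly p₀ τ y).eval z =
      ∑ k, ((x k - y k : ℝ) : ℂ) * (τ k).eval z := by
  simp only [eval_zonotopePoly, add_sub_add_left_eq_sub, ← Finset.sum_sub_distrib,
    Complex.ofReal_sub, sub_mul]

theorem continuous_coeff_zonotopePoly (i : ℕ) :
    Continuous fun x => (zonotopePoly p₀ τ x).coeff i := by
  simp only [zonotopePoly, coeff_add, finsetSum_coeff, coeff_C_mul]
  fun_prop

theorem continuous_eval_zonotopePoly {Y : Type*} [TopologicalSpace Y] {x : Y → ι → ℝ} {z : Y → ℂ}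
    (hx : Continuous x) (hz : Continuous z) :
    Continuous fun y => (zonotopePoly p₀ τ (x y)).eval (z y) := by
  simp only [eval_zonotopePoly]
  refine (p₀.continuous.comp hz).add (continuous_finsetSum _ fun k _ => ?_)
  exact (Complex.continuous_ofReal.comp ((continuous_apply k).comp hx)).mul
    ((τ k).continuous.comp hz)

-- The value set is a compact convex image of the cube, so Hahn–Banach separates it from the origin.
-- The normal has unit length so that normals at different frequencies stay in a compact set and
-- have limits.
open ComplexConjugate in
theorem exists_separating_of_eval_zonotopePoly_ne_zero {z : ℂ}
    (h : ∀ x ∈ Set.Icc (0 : ι → ℝ) 1, (zonotopePoly p₀ τ x).eval z ≠ 0) :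
    ∃ n ∈ Metric.sphere (0 : ℂ) 1, ∀ x ∈ Set.Icc (0 : ι → ℝ) 1,
      (conj n * (zonotopePoly p₀ τ x).eval z).re ≤ 0 := by
  set S : Set ℂ := (fun x => (zonotopePoly p₀ τ x).eval z) '' Set.Icc (0 : ι → ℝ) 1 with hS
  have hcomp : IsCompact S :=
    isCompact_Icc.image (continuous_eval_zonotopePoly continuous_id continuous_const)
  have hconv : Convex ℝ S := by
    rintro _ ⟨x, hx, rfl⟩ _ ⟨y, hy, rfl⟩ a b ha hb hab
    refine ⟨a • x + b • y, (convex_Icc (0 : ι → ℝ) 1) hx hy ha hb hab, ?_⟩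
    have hab' : (a : ℂ) + b = 1 := by exact_mod_cast hab
    simp only [eval_zonotopePoly, Pi.add_apply, Pi.smul_apply, smul_eq_mul, Complex.real_smul,
      Complex.ofReal_add, Complex.ofReal_mul, add_mul, mul_add, Finset.sum_add_distrib,
      Finset.mul_sum, ← mul_assoc]
    linear_combination -(eval z p₀) * hab'
  have h0 : (0 : ℂ) ∉ S := by
    rintro ⟨x, hx, h0⟩
    exact h x hx h0
  obtain ⟨f, u, hf, hu⟩ := geometric_hahn_banach_point_closed hconv hcomp.isClosed h0
  rw [map_zero] at hf
  set m : ℂ := ⟨f 1, f Complex.I⟩ with hm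
  have hfm : ∀ w : ℂ, f w = (conj m * w).re := by
    intro w
    conv_lhs => rw [show w = w.re • (1 : ℂ) + w.im • Complex.I by
      simp [Complex.re_add_im]]
    rw [map_add, map_smul, map_smul]
    simp [hm, Complex.mul_re, mul_comm]
  have hm0 : m ≠ 0 := by
    intro h
    have h1 := hu _ (Set.mem_image_of_mem _ (Set.left_mem_Icc.2 (zero_le_one' (ι → ℝ))))
    rw [hfm, h] at h1
    simp only [map_zero, zero_mul, Complex.zero_re] at h1
    linarith
  have hn : 0 < ‖m‖ := norm_pos_iff.2 hm0
  refine ⟨((-‖m‖⁻¹ : ℝ) : ℂ) * m, by simp [hn.ne'], fun x hx => ?_⟩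
  have h1 := hu _ (Set.mem_image_of_mem _ hx)
  rw [hfm] at h1
  rw [map_mul, Complex.conj_ofReal, mul_assoc, Complex.re_ofReal_mul]
  exact mul_nonpos_of_nonpos_of_nonneg (by simp) (by linarith)

open ComplexConjugate in
/-- Two Hurwitz polynomials whose difference keeps a fixed direction on the imaginary axis do not
have values on opposite sides of the origin along this direction. -/
theorem IsHurwitz.not_opposite {p q : ℂ[X]} (hp : IsHurwitz p) (hq : IsHurwitz q)
    (hpd : 0 < p.natDegree) (hqd : 0 < q.natDegree) {n : ℂ} (hn : ‖n‖ = 1)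
    (hdir : ∀ ω : ℝ, (conj n * (p.eval (ω * Complex.I) - q.eval (ω * Complex.I))).re = 0) {ω : ℝ}
    (hpω : (conj n * p.eval (ω * Complex.I)).re = 0)
    (hp0 : 0 ≤ (conj n * p.eval (ω * Complex.I)).im)
    (hq0 : (conj n * q.eval (ω * Complex.I)).im ≤ 0) : False := by
  have hqω : (conj n * q.eval (ω * Complex.I)).re = 0 := by
    have := hdir ω
    rw [mul_sub, Complex.sub_re, hpω] at this
    linarith
  have hnn : n * conj n = 1 := by
    rw [Complex.mul_conj, Complex.normSq_eq_norm_sq, hn]; simp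
  -- When the rotated value `w` is purely imaginary, increasing phase says that the velocity of its
  -- real part has the sign opposite to `w.im`.
  have key : ∀ r : ℂ[X], IsHurwitz r → 0 < r.natDegree →
      (conj n * r.eval (ω * Complex.I)).re = 0 →
      (conj n * r.eval (ω * Complex.I)).im *
        (conj n * (r.derivative.eval (ω * Complex.I) * Complex.I)).re < 0 := by
    intro r hr hd hre
    have h1 := hr.re_derivative_mul_conj_pos hd (z := ω * Complex.I) (by simp)
    set w := conj n * r.eval (ω * Complex.I) with hw
    have h2 : r.eval (ω * Complex.I) = n * w := by rw [hw, ← mul_assoc, hnn, one_mul]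
    have h3 : conj w = -(w.im * Complex.I) := by
      apply Complex.ext <;> simp [hre]
    rw [h2, map_mul, h3] at h1
    have h4 : eval (ω * Complex.I) (derivative r) * (conj n * -(w.im * Complex.I)) =
        ((-w.im : ℝ) : ℂ) * (conj n * (r.derivative.eval (ω * Complex.I) * Complex.I)) := by
      push_cast; ring
    rw [h4, Complex.re_ofReal_mul] at h1
    linarith
  have hP := key p hp hpd hpω
  have hQ := key q hq hqd hqω
  have hder : (conj n * (p.derivative.eval (ω * Complex.I) * Complex.I)).re =
      (conj n * (q.derivative.eval (ω * Complex.I) * Complex.I)).re := by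
    have h1 : HasDerivAt (fun z : ℂ => conj n * (p - q).eval (z * Complex.I))
        (conj n * ((p - q).derivative.eval (ω * Complex.I) * Complex.I)) (ω : ℂ) := by
      refine HasDerivAt.const_mul _ ?_
      have h2 : HasDerivAt (fun z : ℂ => z * Complex.I) (1 * Complex.I) (ω : ℂ) :=
        (hasDerivAt_id _).mul_const _
      rw [one_mul] at h2
      exact ((p - q).hasDerivAt _).comp (ω : ℂ) h2
    have h2 := h1.real_of_complex
    have h3 : (fun x : ℝ => (conj n * (p - q).eval ((x : ℂ) * Complex.I)).re) = fun _ => 0 := by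
      funext x
      rw [eval_sub]
      exact hdir x
    rw [h3] at h2
    have h4 := h2.unique (hasDerivAt_const ω (0 : ℝ))
    rw [derivative_sub, eval_sub, sub_mul, mul_sub, Complex.sub_re] at h4
    linarith
  rw [hder] at hP
  rcases le_total 0 (conj n * (q.derivative.eval (ω * Complex.I) * Complex.I)).re with h | h
  · linarith [mul_nonneg hp0 h]
  · linarith [mul_nonneg_of_nonpos_of_nonpos hq0 h]

-- The generators have fixed directions `g k` on the axis, so a normal `n` selects the same face
-- directions at every frequency. The ends of the face through a boundary zero then satisfy the
-- hypotheses of `IsHurwitz.not_opposite`.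
open ComplexConjugate in
theorem eval_zonotopePoly_ne_zero_of_vertices_isHurwitz {g : ι → ℂ} {T : ι → ℝ → ℝ}
    (hT : ∀ k (ω : ℝ), (τ k).eval (ω * Complex.I) = T k ω * g k)
    {ε : ℝ} (hε : ε ≠ 0) (hTpos : ∀ k ω, 0 ≤ ω → 0 ≤ T k (ε * ω)) {d : ℕ} (hd : 0 < d)
    (hdeg : ∀ x ∈ Set.Icc (0 : ι → ℝ) 1, (zonotopePoly p₀ τ x).degree = d)
    (hvert : ∀ x : ι → ℝ, (∀ k, x k = 0 ∨ x k = 1) → IsHurwitz (zonotopePoly p₀ τ x))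
    {x : ι → ℝ} (hx : x ∈ Set.Icc (0 : ι → ℝ) 1) {ω : ℝ} (hω : 0 ≤ ω) :
    (zonotopePoly p₀ τ x).eval ((ε * ω : ℝ) * Complex.I) ≠ 0 := by
  classical
  intro hzero
  obtain ⟨R, hR⟩ := exists_bound_roots_of_isCompact isCompact_Icc continuous_coeff_zonotopePoly hdeg
  have heval : Continuous fun y : ℝ × (ι → ℝ) =>
      (zonotopePoly p₀ τ y.2).eval ((ε * y.1 : ℝ) * Complex.I) :=
    continuous_eval_zonotopePoly continuous_snd (by fun_prop)
  -- The set of nonnegative frequencies at which some member of the family vanishes.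
  set A : Set ℝ := Prod.fst '' ((Set.Icc 0 (R / |ε|) ×ˢ Set.Icc (0 : ι → ℝ) 1) ∩
    {y : ℝ × (ι → ℝ) | (zonotopePoly p₀ τ y.2).eval ((ε * y.1 : ℝ) * Complex.I) = 0}) with hA
  have hAmem : ∀ w, 0 ≤ w → ∀ y ∈ Set.Icc (0 : ι → ℝ) 1,
      (zonotopePoly p₀ τ y).eval ((ε * w : ℝ) * Complex.I) = 0 → w ∈ A := by
    intro w hw y hy h
    refine ⟨(w, y), ⟨⟨⟨hw, ?_⟩, hy⟩, h⟩, rfl⟩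
    have h1 := hR y hy _ h
    rw [norm_mul, Complex.norm_I, mul_one, Complex.norm_real, Real.norm_eq_abs, abs_mul,
      abs_of_nonneg hw] at h1
    rw [le_div_iff₀ (abs_pos.2 hε)]
    linarith
  have hAc : IsCompact A := by
    refine IsCompact.image ?_ continuous_fst
    exact (isCompact_Icc.prod isCompact_Icc).inter_right (isClosed_eq heval continuous_const)
  obtain ⟨w₀, hw₀, hmax⟩ := hAc.exists_isGreatest ⟨ω, hAmem ω hω x hx hzero⟩
  obtain ⟨⟨w, x₀⟩, ⟨⟨⟨hw0, -⟩, hx₀⟩, hz₀⟩, hww⟩ := hw₀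
  dsimp only at hw0 hx₀ hz₀ hww
  subst hww
  -- The frequencies at which the origin is not interior to the value set.
  set B : Set ℝ := Prod.fst '' ((Set.Icc w (w + 1) ×ˢ Metric.sphere (0 : ℂ) 1) ∩
    {y : ℝ × ℂ | ∀ x ∈ Set.Icc (0 : ι → ℝ) 1,
      (conj y.2 * (zonotopePoly p₀ τ x).eval ((ε * y.1 : ℝ) * Complex.I)).re ≤ 0}) with hB
  have hBc : IsClosed B := by
    refine IsCompact.isClosed (IsCompact.image ?_ continuous_fst)
    refine (isCompact_Icc.prod (isCompact_sphere 0 1)).inter_right ?_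
    simp only [Set.ofPred_forall]
    refine isClosed_iInter fun x => isClosed_iInter fun _ => isClosed_le ?_ continuous_const
    refine Complex.continuous_re.comp (Continuous.mul (by fun_prop) ?_)
    exact heval.comp (continuous_fst.prodMk continuous_const)
  -- Beyond the greatest zero frequency `w` no member vanishes, so separating normals exist.
  -- Closedness of `B` then yields a supporting normal at `w` itself.
  have hBsub : Set.Ioc w (w + 1) ⊆ B := by
    intro v hv
    obtain ⟨n, hn, hsep⟩ := exists_separating_of_eval_zonotopePoly_ne_zero
      (p₀ := p₀) (τ := τ) (z := (ε * v : ℝ) * Complex.I) (fun y hy h =>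
        absurd (hmax (hAmem v (hw0.trans hv.1.le) y hy h)) (not_le.2 hv.1))
    exact ⟨(v, n), ⟨⟨⟨hv.1.le, hv.2⟩, hn⟩, hsep⟩, rfl⟩
  have hwB : w ∈ B := by
    refine hBc.closure_subset_iff.2 hBsub ?_
    rw [closure_Ioc (by linarith)]
    exact Set.left_mem_Icc.2 (by linarith)
  obtain ⟨⟨w', n⟩, ⟨⟨-, hn⟩, hsep⟩, hww⟩ := hwB
  dsimp only at hn hsep hww
  subst hww
  rw [mem_sphere_zero_iff_norm] at hn
  have hval : ∀ (y : ι → ℝ) (v : ℝ) (y' : ι → ℝ),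
      conj n * ((zonotopePoly p₀ τ y).eval (v * Complex.I) -
        (zonotopePoly p₀ τ y').eval (v * Complex.I)) =
        ∑ k, (((y k - y' k) * T k v : ℝ) : ℂ) * (conj n * g k) := by
    intro y v y'
    rw [eval_zonotopePoly_sub, Finset.mul_sum]
    refine Finset.sum_congr rfl fun k _ => ?_
    rw [hT]; push_cast; ring
  -- Round the coordinates so that the functional attains its maximum.
  let rnd : (ι → Bool) → ι → ℝ := fun s k =>
    if 0 < (conj n * g k).re then 1 else if (conj n * g k).re < 0 then 0 else if s k then 1 else 0
  have hrnd01 : ∀ s k, rnd s k = 0 ∨ rnd s k = 1 := by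
    intro s k
    dsimp only [rnd]
    split_ifs <;> simp
  have hrndI : ∀ s, rnd s ∈ Set.Icc (0 : ι → ℝ) 1 := by
    intro s
    constructor <;> intro k <;> rcases hrnd01 s k with h | h <;> simp [h]
  have hrnd0 : ∀ s k, (conj n * g k).re = 0 → rnd s k = if s k then 1 else 0 := by
    intro s k hk
    dsimp only [rnd]
    rw [if_neg hk.not_gt, if_neg hk.not_lt]
  have hTw : ∀ k, 0 ≤ T k (ε * w') := fun k => hTpos k w' hw0
  have hterm : ∀ s k, 0 ≤ (rnd s k - x₀ k) * T k (ε * w') * (conj n * g k).re := by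
    intro s k
    have h0 : 0 ≤ x₀ k := hx₀.1 k
    have h1 : x₀ k ≤ 1 := hx₀.2 k
    rcases lt_trichotomy (conj n * g k).re 0 with h | h | h
    · have : rnd s k = 0 := (if_neg h.not_gt).trans (if_pos h)
      rw [this]
      exact mul_nonneg_of_nonpos_of_nonpos
        (mul_nonpos_of_nonpos_of_nonneg (by linarith) (hTw k)) h.le
    · rw [h, mul_zero]
    · have : rnd s k = 1 := if_pos h
      rw [this]
      exact mul_nonneg (mul_nonneg (by linarith) (hTw k)) h.le
  have hdiff : ∀ s, conj n * (zonotopePoly p₀ τ (rnd s)).eval ((ε * w' : ℝ) * Complex.I) =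
      ∑ k, (((rnd s k - x₀ k) * T k (ε * w') : ℝ) : ℂ) * (conj n * g k) := by
    intro s
    rw [← hval, hz₀, sub_zero]
  have hre : ∀ s, (conj n * (zonotopePoly p₀ τ (rnd s)).eval ((ε * w' : ℝ) * Complex.I)).re =
      ∑ k, (rnd s k - x₀ k) * T k (ε * w') * (conj n * g k).re := by
    intro s
    rw [hdiff, Complex.re_sum]
    exact Finset.sum_congr rfl fun k _ => Complex.re_ofReal_mul _ _
  have him : ∀ s, (conj n * (zonotopePoly p₀ τ (rnd s)).eval ((ε * w' : ℝ) * Complex.I)).im =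
      ∑ k, (rnd s k - x₀ k) * T k (ε * w') * (conj n * g k).im := by
    intro s
    rw [hdiff, Complex.im_sum]
    exact Finset.sum_congr rfl fun k _ => Complex.im_ofReal_mul _ _
  -- The supporting normal gives `≤ 0`; rounding never decreases the functional, whose value at `x₀`
  -- is zero, and this gives `≥ 0`.
  have hre0 : ∀ s, (conj n * (zonotopePoly p₀ τ (rnd s)).eval ((ε * w' : ℝ) * Complex.I)).re = 0 :=
    fun s => le_antisymm (hsep _ (hrndI s))
      ((hre s).symm ▸ Finset.sum_nonneg fun k _ => hterm s k)
  have hterm0 : ∀ s k, (conj n * g k).re ≠ 0 → (rnd s k - x₀ k) * T k (ε * w') = 0 := by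
    intro s k hk
    have h := (Finset.sum_eq_zero_iff_of_nonneg fun k _ => hterm s k).1
      ((hre s).symm.trans (hre0 s)) k (Finset.mem_univ k)
    exact (mul_eq_zero.1 h).resolve_right hk
  -- Only generators orthogonal to `n` remain free. Rounding all of them one way or all the other
  -- way along the face gives its two ends, with the origin between them.
  let s₁ : ι → Bool := fun k => decide (0 ≤ (conj n * g k).im)
  let s₂ : ι → Bool := fun k => decide ((conj n * g k).im < 0)
  have hnat : ∀ s, 0 < (zonotopePoly p₀ τ (rnd s)).natDegree := fun s => by
    rwa [natDegree_eq_of_degree_eq_some (hdeg _ (hrndI s))]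
  refine IsHurwitz.not_opposite (hvert _ (hrnd01 s₁)) (hvert _ (hrnd01 s₂)) (hnat s₁) (hnat s₂)
    hn ?_ (hre0 s₁) ?_ ?_
  · intro v
    rw [hval, Complex.re_sum]
    refine Finset.sum_eq_zero fun k _ => ?_
    rw [Complex.re_ofReal_mul]
    by_cases hk : (conj n * g k).re = 0
    · rw [hk, mul_zero]
    · have : rnd s₁ k = rnd s₂ k := by
        rcases lt_or_gt_of_ne hk with h | h
        · exact ((if_neg h.not_gt).trans (if_pos h)).trans ((if_neg h.not_gt).trans (if_pos h)).symm
        · exact (if_pos h).trans (if_pos h).symm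
      rw [this, sub_self, zero_mul, zero_mul]
  · rw [him]
    refine Finset.sum_nonneg fun k _ => ?_
    by_cases hk : (conj n * g k).re = 0
    · have h0 : 0 ≤ x₀ k := hx₀.1 k
      have h1 : x₀ k ≤ 1 := hx₀.2 k
      rw [hrnd0 s₁ k hk]
      by_cases h : 0 ≤ (conj n * g k).im
      · simp only [s₁, h, decide_true, if_true]
        exact mul_nonneg (mul_nonneg (by linarith) (hTw k)) h
      · simp only [s₁, h, decide_false]
        exact mul_nonneg_of_nonpos_of_nonpos
          (mul_nonpos_of_nonpos_of_nonneg (by simpa using h0) (hTw k)) (not_le.1 h).le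
    · rw [hterm0 s₁ k hk, zero_mul]
  · rw [him]
    refine Finset.sum_nonpos fun k _ => ?_
    by_cases hk : (conj n * g k).re = 0
    · have h0 : 0 ≤ x₀ k := hx₀.1 k
      have h1 : x₀ k ≤ 1 := hx₀.2 k
      rw [hrnd0 s₂ k hk]
      by_cases h : (conj n * g k).im < 0
      · simp only [s₂, h, decide_true, if_true]
        exact mul_nonpos_of_nonneg_of_nonpos (mul_nonneg (by linarith) (hTw k)) h.le
      · simp only [s₂, h, decide_false]
        exact mul_nonpos_of_nonpos_of_nonneg
          (mul_nonpos_of_nonpos_of_nonneg (by simpa using h0) (hTw k)) (not_lt.1 h)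
    · rw [hterm0 s₂ k hk, zero_mul]

end zonotopePoly

/-! ### Kharitonov rectangles of an interval family. -/

namespace ComplexInterval

theorem convex_family (D : ComplexInterval) : Convex ℝ D.family := by
  rintro _ ⟨α, β, hα, hβ, rfl⟩ _ ⟨α', β', hα', hβ', rfl⟩ a b ha hb hab
  refine ⟨fun i => a • α i + b • α' i, fun i => a • β i + b • β' i,
    fun i hi => convex_Icc _ _ (hα i hi) (hα' i hi) ha hb hab,
    fun i hi => convex_Icc _ _ (hβ i hi) (hβ' i hi) ha hb hab, ?_⟩
  rw [Finset.smul_sum, Finset.smul_sum, ← Finset.sum_add_distrib]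
  refine Finset.sum_congr rfl fun i _ => ?_
  rw [← smul_mul_assoc, ← smul_mul_assoc, ← add_mul, smul_C, smul_C, ← C_add]
  congr 2
  apply Complex.ext <;> simp

theorem vertex_mem_family (D : ComplexInterval) (a b : Fin 4 → Bool) : D.vertex a b ∈ D.family := by
  refine ⟨_, _, fun i hi => ?_, fun i hi => ?_, rfl⟩
  · have := D.re_le i hi
    split_ifs <;> simp [this]
  · have := D.im_le i hi
    split_ifs <;> simp [this]

/-- On the half-line `j ε ω`, `ω ≥ 0`, the values of the family lie in a rectangle with sides
parallel to the axes and with vertices `K 0`, `K 1`, `K 2`, `K 3` (lower left, upper left, lower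
right and upper right). -/
structure IsRectangle (D : ComplexInterval) (K : Fin 4 → ℂ[X]) (ε : ℝ) : Prop where
  mem : ∀ i, K i ∈ D.family
  eq_three : K 3 = K 1 + K 2 - K 0
  im_eq_zero : ∀ ω : ℝ, ((K 2 - K 0).eval (ω * Complex.I)).im = 0
  re_eq_zero : ∀ ω : ℝ, ((K 1 - K 0).eval (ω * Complex.I)).re = 0
  re_mem : ∀ u ∈ D.family, ∀ ω : ℝ, 0 ≤ ω → (u.eval ((ε * ω : ℝ) * Complex.I)).re ∈
    Set.Icc ((K 0).eval ((ε * ω : ℝ) * Complex.I)).re ((K 2).eval ((ε * ω : ℝ) * Complex.I)).re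
  im_mem : ∀ u ∈ D.family, ∀ ω : ℝ, 0 ≤ ω → (u.eval ((ε * ω : ℝ) * Complex.I)).im ∈
    Set.Icc ((K 0).eval ((ε * ω : ℝ) * Complex.I)).im ((K 1).eval ((ε * ω : ℝ) * Complex.I)).im

theorem mod_four_cases (i : ℕ) :
    (Fin.ofNat 4 i = 0 ∧ Complex.I ^ i = 1 ∧ (-Complex.I) ^ i = 1) ∨
    (Fin.ofNat 4 i = 1 ∧ Complex.I ^ i = Complex.I ∧ (-Complex.I) ^ i = -Complex.I) ∨
    (Fin.ofNat 4 i = 2 ∧ Complex.I ^ i = -1 ∧ (-Complex.I) ^ i = -1) ∨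
    (Fin.ofNat 4 i = 3 ∧ Complex.I ^ i = -Complex.I ∧ (-Complex.I) ^ i = Complex.I) := by
  have h4 : (-Complex.I) ^ 4 = 1 := by rw [Even.neg_pow (by decide), Complex.I_pow_four]
  have h3 : (-Complex.I) ^ 3 = Complex.I := by
    rw [Odd.neg_pow (by decide), Complex.I_pow_three, neg_neg]
  have hneg : (-Complex.I) ^ i = (-Complex.I) ^ (i % 4) := by
    conv_lhs => rw [← Nat.mod_add_div i 4, pow_add, pow_mul, h4, one_pow, mul_one]
  have hfin : Fin.ofNat 4 i = Fin.ofNat 4 (i % 4) := by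
    apply Fin.ext; simp [Fin.ofNat]
  rw [hneg, Complex.I_pow_eq_pow_mod, hfin]
  have : i % 4 < 4 := Nat.mod_lt _ (by norm_num)
  interval_cases i % 4
  · left; simp
  · right; left; simp; rfl
  · right; right; left; simp
  · right; right; right; simp only [h3, Complex.I_pow_three, and_self, and_true]; rfl

theorem eval_sum_C_mul_X_pow (N : ℕ) (c : ℕ → ℂ) (z : ℂ) :
    (∑ i ∈ Finset.range N, C (c i) * X ^ i).eval z = ∑ i ∈ Finset.range N, c i * z ^ i := by
  simp [eval_finsetSum]

/-- Powers of `j` cycle through `1, j, -1, -j`, so the real part of the `i`-th term is `α`, `-β`,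
`-α`, `β` times `ω ^ i`, and the imaginary part is `β`, `α`, `-β`, `-α` times `ω ^ i`. The sign
pattern of each vertex makes both parts extremal term by term when `ω ≥ 0`. -/
theorem isRectangle_kPlus (D : ComplexInterval) : D.IsRectangle D.kPlus 1 where
  mem i := by fin_cases i <;> exact vertex_mem_family ..
  eq_three := by
    simp only [kPlus, vertex, Matrix.cons_val]
    rw [eq_sub_iff_add_eq, ← Finset.sum_add_distrib, ← Finset.sum_add_distrib]
    refine Finset.sum_congr rfl fun i _ => ?_
    rw [← add_mul, ← add_mul, ← C_add, ← C_add]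
    congr 2
    rcases mod_four_cases i with ⟨h, -, -⟩ | ⟨h, -, -⟩ | ⟨h, -, -⟩ | ⟨h, -, -⟩ <;>
      rw [h] <;> apply Complex.ext <;> simp [add_comm]
  im_eq_zero ω := by
    simp only [kPlus, vertex, Matrix.cons_val]
    rw [eval_sub, eval_sum_C_mul_X_pow, eval_sum_C_mul_X_pow, ← Finset.sum_sub_distrib,
      Complex.im_sum]
    refine Finset.sum_eq_zero fun i _ => ?_
    rw [mul_pow, ← Complex.ofReal_pow]
    rcases mod_four_cases i with ⟨h, h', -⟩ | ⟨h, h', -⟩ | ⟨h, h', -⟩ | ⟨h, h', -⟩ <;>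
      rw [h, h'] <;> simp [-Complex.ofReal_pow]
  re_eq_zero ω := by
    simp only [kPlus, vertex, Matrix.cons_val]
    rw [eval_sub, eval_sum_C_mul_X_pow, eval_sum_C_mul_X_pow, ← Finset.sum_sub_distrib,
      Complex.re_sum]
    refine Finset.sum_eq_zero fun i _ => ?_
    rw [mul_pow, ← Complex.ofReal_pow]
    rcases mod_four_cases i with ⟨h, h', -⟩ | ⟨h, h', -⟩ | ⟨h, h', -⟩ | ⟨h, h', -⟩ <;>
      rw [h, h'] <;> simp [-Complex.ofReal_pow]
  re_mem := by
    rintro _ ⟨α, β, hα, hβ, rfl⟩ ω hω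
    simp only [kPlus, vertex, Matrix.cons_val, one_mul]
    rw [eval_sum_C_mul_X_pow, eval_sum_C_mul_X_pow, eval_sum_C_mul_X_pow, Complex.re_sum,
      Complex.re_sum, Complex.re_sum]
    constructor <;> refine Finset.sum_le_sum fun i hi => ?_ <;>
    · rw [mul_pow, ← Complex.ofReal_pow]
      have hi' : i ≤ D.order := Nat.lt_succ_iff.1 (Finset.mem_range.1 hi)
      have h1 := mul_le_mul_of_nonneg_right (hα i hi').1 (pow_nonneg hω i)
      have h2 := mul_le_mul_of_nonneg_right (hα i hi').2 (pow_nonneg hω i)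
      have h3 := mul_le_mul_of_nonneg_right (hβ i hi').1 (pow_nonneg hω i)
      have h4 := mul_le_mul_of_nonneg_right (hβ i hi').2 (pow_nonneg hω i)
      rcases mod_four_cases i with ⟨h, h', -⟩ | ⟨h, h', -⟩ | ⟨h, h', -⟩ | ⟨h, h', -⟩ <;>
        rw [h, h'] <;> simp [-Complex.ofReal_pow] <;> assumption
  im_mem := by
    rintro _ ⟨α, β, hα, hβ, rfl⟩ ω hω
    simp only [kPlus, vertex, Matrix.cons_val, one_mul]
    rw [eval_sum_C_mul_X_pow, eval_sum_C_mul_X_pow, eval_sum_C_mul_X_pow, Complex.im_sum,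
      Complex.im_sum, Complex.im_sum]
    constructor <;> refine Finset.sum_le_sum fun i hi => ?_ <;>
    · rw [mul_pow, ← Complex.ofReal_pow]
      have hi' : i ≤ D.order := Nat.lt_succ_iff.1 (Finset.mem_range.1 hi)
      have h1 := mul_le_mul_of_nonneg_right (hα i hi').1 (pow_nonneg hω i)
      have h2 := mul_le_mul_of_nonneg_right (hα i hi').2 (pow_nonneg hω i)
      have h3 := mul_le_mul_of_nonneg_right (hβ i hi').1 (pow_nonneg hω i)
      have h4 := mul_le_mul_of_nonneg_right (hβ i hi').2 (pow_nonneg hω i)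
      rcases mod_four_cases i with ⟨h, h', -⟩ | ⟨h, h', -⟩ | ⟨h, h', -⟩ | ⟨h, h', -⟩ <;>
        rw [h, h'] <;> simp [-Complex.ofReal_pow] <;> assumption

theorem neg_mul_I_eq (ω : ℝ) : ((-1 * ω : ℝ) : ℂ) * Complex.I = ω * -Complex.I := by
  push_cast; ring

/-- On the negative half-axis the odd powers change sign, which reverses the endpoint choices at odd
indices. -/
theorem isRectangle_kMinus (D : ComplexInterval) : D.IsRectangle D.kMinus (-1) where
  mem i := by fin_cases i <;> exact vertex_mem_family ..
  eq_three := by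
    simp only [kMinus, vertex, Matrix.cons_val]
    rw [eq_sub_iff_add_eq, ← Finset.sum_add_distrib, ← Finset.sum_add_distrib]
    refine Finset.sum_congr rfl fun i _ => ?_
    rw [← add_mul, ← add_mul, ← C_add, ← C_add]
    congr 2
    rcases mod_four_cases i with ⟨h, -, -⟩ | ⟨h, -, -⟩ | ⟨h, -, -⟩ | ⟨h, -, -⟩ <;>
      rw [h] <;> apply Complex.ext <;> simp [add_comm]
  im_eq_zero ω := by
    simp only [kMinus, vertex, Matrix.cons_val]
    rw [eval_sub, eval_sum_C_mul_X_pow, eval_sum_C_mul_X_pow, ← Finset.sum_sub_distrib,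
      Complex.im_sum]
    refine Finset.sum_eq_zero fun i _ => ?_
    rw [mul_pow, ← Complex.ofReal_pow]
    rcases mod_four_cases i with ⟨h, h', -⟩ | ⟨h, h', -⟩ | ⟨h, h', -⟩ | ⟨h, h', -⟩ <;>
      rw [h, h'] <;> simp [-Complex.ofReal_pow]
  re_eq_zero ω := by
    simp only [kMinus, vertex, Matrix.cons_val]
    rw [eval_sub, eval_sum_C_mul_X_pow, eval_sum_C_mul_X_pow, ← Finset.sum_sub_distrib,
      Complex.re_sum]
    refine Finset.sum_eq_zero fun i _ => ?_
    rw [mul_pow, ← Complex.ofReal_pow]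
    rcases mod_four_cases i with ⟨h, h', -⟩ | ⟨h, h', -⟩ | ⟨h, h', -⟩ | ⟨h, h', -⟩ <;>
      rw [h, h'] <;> simp [-Complex.ofReal_pow]
  re_mem := by
    rintro _ ⟨α, β, hα, hβ, rfl⟩ ω hω
    simp only [kMinus, vertex, Matrix.cons_val, neg_mul_I_eq ω]
    rw [eval_sum_C_mul_X_pow, eval_sum_C_mul_X_pow, eval_sum_C_mul_X_pow, Complex.re_sum,
      Complex.re_sum, Complex.re_sum]
    constructor <;> refine Finset.sum_le_sum fun i hi => ?_ <;>
    · rw [mul_pow, ← Complex.ofReal_pow]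
      have hi' : i ≤ D.order := Nat.lt_succ_iff.1 (Finset.mem_range.1 hi)
      have h1 := mul_le_mul_of_nonneg_right (hα i hi').1 (pow_nonneg hω i)
      have h2 := mul_le_mul_of_nonneg_right (hα i hi').2 (pow_nonneg hω i)
      have h3 := mul_le_mul_of_nonneg_right (hβ i hi').1 (pow_nonneg hω i)
      have h4 := mul_le_mul_of_nonneg_right (hβ i hi').2 (pow_nonneg hω i)
      rcases mod_four_cases i with ⟨h, -, h'⟩ | ⟨h, -, h'⟩ | ⟨h, -, h'⟩ | ⟨h, -, h'⟩ <;>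
        rw [h, h'] <;> simp [-Complex.ofReal_pow] <;> assumption
  im_mem := by
    rintro _ ⟨α, β, hα, hβ, rfl⟩ ω hω
    simp only [kMinus, vertex, Matrix.cons_val, neg_mul_I_eq ω]
    rw [eval_sum_C_mul_X_pow, eval_sum_C_mul_X_pow, eval_sum_C_mul_X_pow, Complex.im_sum,
      Complex.im_sum, Complex.im_sum]
    constructor <;> refine Finset.sum_le_sum fun i hi => ?_ <;>
    · rw [mul_pow, ← Complex.ofReal_pow]
      have hi' : i ≤ D.order := Nat.lt_succ_iff.1 (Finset.mem_range.1 hi)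
      have h1 := mul_le_mul_of_nonneg_right (hα i hi').1 (pow_nonneg hω i)
      have h2 := mul_le_mul_of_nonneg_right (hα i hi').2 (pow_nonneg hω i)
      have h3 := mul_le_mul_of_nonneg_right (hβ i hi').1 (pow_nonneg hω i)
      have h4 := mul_le_mul_of_nonneg_right (hβ i hi').2 (pow_nonneg hω i)
      rcases mod_four_cases i with ⟨h, -, h'⟩ | ⟨h, -, h'⟩ | ⟨h, -, h'⟩ | ⟨h, -, h'⟩ <;>
        rw [h, h'] <;> simp [-Complex.ofReal_pow] <;> assumption

end ComplexInterval

/-! ### Stability of a linear combination of two interval families. -/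

namespace ComplexInterval

variable {D : ComplexInterval} {K : Fin 4 → ℂ[X]} {ε : ℝ}

/-- The polynomial with coordinates `x` and `y` relative to the three vertices `K 0`, `K 2`, `K 1`
of a parallelogram. -/
noncomputable def rectPoly (K : Fin 4 → ℂ[X]) (x y : ℝ) : ℂ[X] :=
  K 0 + C (x : ℂ) * (K 2 - K 0) + C (y : ℂ) * (K 1 - K 0)

theorem IsRectangle.rectPoly_mem (h : D.IsRectangle K ε) {x y : ℝ} (hx : x ∈ Set.Icc (0 : ℝ) 1)
    (hy : y ∈ Set.Icc (0 : ℝ) 1) : rectPoly K x y ∈ D.family := by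
  -- Interpolate on two opposite sides, then between them; the parallelogram relation `eq_three`
  -- removes the bilinear term.
  have h0 := D.convex_family (h.mem 0) (h.mem 2) (sub_nonneg.2 hx.2) hx.1 (by ring)
  have h1 := D.convex_family (h.mem 1) (h.mem 3) (sub_nonneg.2 hx.2) hx.1 (by ring)
  have h2 := D.convex_family h0 h1 (sub_nonneg.2 hy.2) hy.1 (by ring)
  convert h2 using 1
  rw [h.eq_three]
  ext i
  simp [rectPoly]
  ring

theorem IsRectangle.exists_eq_rectPoly (h : D.IsRectangle K ε) {x y : ℝ} (hx : x = 0 ∨ x = 1)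
    (hy : y = 0 ∨ y = 1) : ∃ i, rectPoly K x y = K i := by
  rcases hx with rfl | rfl <;> rcases hy with rfl | rfl
  · exact ⟨0, by simp [rectPoly]⟩
  · exact ⟨1, by simp [rectPoly]⟩
  · exact ⟨2, by simp [rectPoly]⟩
  · exact ⟨3, by rw [h.eq_three, rectPoly]; simp; ring⟩

theorem exists_mem_Icc_eq_add_mul {a b c : ℝ} (h : c ∈ Set.Icc a b) :
    ∃ x ∈ Set.Icc (0 : ℝ) 1, c = a + x * (b - a) := by
  rcases eq_or_lt_of_le (h.1.trans h.2) with hab | hab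
  · exact ⟨0, by simp, by linarith [h.1, h.2]⟩
  · have hba : 0 < b - a := sub_pos.2 hab
    refine ⟨(c - a) / (b - a), ⟨div_nonneg (sub_nonneg.2 h.1) hba.le, ?_⟩, ?_⟩
    · rw [div_le_one hba]; linarith [h.2]
    · field_simp; ring

theorem IsRectangle.exists_eval_eq (h : D.IsRectangle K ε) {u : ℂ[X]} (hu : u ∈ D.family) {ω : ℝ}
    (hω : 0 ≤ ω) : ∃ x ∈ Set.Icc (0 : ℝ) 1, ∃ y ∈ Set.Icc (0 : ℝ) 1,
      u.eval ((ε * ω : ℝ) * Complex.I) = (rectPoly K x y).eval ((ε * ω : ℝ) * Complex.I) := by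
  obtain ⟨x, hx, hxe⟩ := exists_mem_Icc_eq_add_mul (h.re_mem u hu ω hω)
  obtain ⟨y, hy, hye⟩ := exists_mem_Icc_eq_add_mul (h.im_mem u hu ω hω)
  refine ⟨x, hx, y, hy, ?_⟩
  have h1 := h.im_eq_zero (ε * ω)
  have h2 := h.re_eq_zero (ε * ω)
  rw [eval_sub] at h1 h2
  rw [rectPoly, eval_add, eval_add, eval_mul, eval_mul, eval_C, eval_C, eval_sub, eval_sub]
  apply Complex.ext
  · rw [Complex.add_re, Complex.add_re, Complex.re_ofReal_mul, Complex.re_ofReal_mul, h2, hxe,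
      Complex.sub_re]
    ring
  · rw [Complex.add_im, Complex.add_im, Complex.im_ofReal_mul, Complex.im_ofReal_mul, h1, hye,
      Complex.sub_im]
    ring

variable {Du Dv : ComplexInterval} {a b : ℂ} {d : ℕ}

/-- At the given frequency `u` and `v` can be replaced by points of their parallelograms with the
same values. The combination then belongs to a zonotope with four generators, two for each
rectangle, whose vertices are combinations of Kharitonov polynomials. -/
theorem IsRectangle.eval_linearCombination_ne_zero {Ku Kv : Fin 4 → ℂ[X]} (hu : Du.IsRectangle Ku ε)
    (hv : Dv.IsRectangle Kv ε) (hε : ε ≠ 0) (hd : 0 < d)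
    (hdeg : ∀ u ∈ Du.family, ∀ v ∈ Dv.family, (C a * u + C b * v).degree = d)
    (hvert : ∀ i j, IsHurwitz (C a * Ku i + C b * Kv j)) {u v : ℂ[X]} (hum : u ∈ Du.family)
    (hvm : v ∈ Dv.family) {ω : ℝ} (hω : 0 ≤ ω) :
    (C a * u + C b * v).eval ((ε * ω : ℝ) * Complex.I) ≠ 0 := by
  let τ : Fin 4 → ℂ[X] := ![C a * (Ku 2 - Ku 0), C a * (Ku 1 - Ku 0), C b * (Kv 2 - Kv 0),
    C b * (Kv 1 - Kv 0)]
  let g : Fin 4 → ℂ := ![a, a * Complex.I, b, b * Complex.I]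
  let T : Fin 4 → ℝ → ℝ := ![fun ω => ((Ku 2 - Ku 0).eval (ω * Complex.I)).re,
    fun ω => ((Ku 1 - Ku 0).eval (ω * Complex.I)).im,
    fun ω => ((Kv 2 - Kv 0).eval (ω * Complex.I)).re,
    fun ω => ((Kv 1 - Kv 0).eval (ω * Complex.I)).im]
  have hz : ∀ x, zonotopePoly (C a * Ku 0 + C b * Kv 0) τ x =
      C a * rectPoly Ku (x 0) (x 1) + C b * rectPoly Kv (x 2) (x 3) := by
    intro x
    simp only [zonotopePoly, rectPoly, Fin.sum_univ_four, τ, Matrix.cons_val]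
    ring
  have hre : ∀ w : ℂ, w.im = 0 → ∀ c, c * w = w.re * c := fun w hw c => by
    rw [mul_comm]; congr 1; exact Complex.ext rfl (by simp [hw])
  have him : ∀ w : ℂ, w.re = 0 → ∀ c, c * w = w.im * (c * Complex.I) := fun w hw c => by
    conv_lhs => rw [← Complex.re_add_im w, hw]
    push_cast; ring
  have hT : ∀ k (ω : ℝ), (τ k).eval (ω * Complex.I) = T k ω * g k := by
    intro k ω
    fin_cases k
    · exact (eval_mul.trans (by rw [eval_C])).trans (hre _ (hu.im_eq_zero ω) a)
    · exact (eval_mul.trans (by rw [eval_C])).trans (him _ (hu.re_eq_zero ω) a)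
    · exact (eval_mul.trans (by rw [eval_C])).trans (hre _ (hv.im_eq_zero ω) b)
    · exact (eval_mul.trans (by rw [eval_C])).trans (him _ (hv.re_eq_zero ω) b)
  have hnn : ∀ {D : ComplexInterval} {K : Fin 4 → ℂ[X]}, D.IsRectangle K ε → ∀ ω : ℝ, 0 ≤ ω →
      0 ≤ ((K 2 - K 0).eval ((ε * ω : ℝ) * Complex.I)).re ∧
      0 ≤ ((K 1 - K 0).eval ((ε * ω : ℝ) * Complex.I)).im := by
    intro D K h ω hω
    rw [eval_sub, eval_sub, Complex.sub_re, Complex.sub_im]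
    exact ⟨sub_nonneg.2 (h.re_mem _ (h.mem 2) ω hω).1, sub_nonneg.2 (h.im_mem _ (h.mem 1) ω hω).1⟩
  have hTpos : ∀ k ω, 0 ≤ ω → 0 ≤ T k (ε * ω) := by
    intro k ω hω
    fin_cases k
    · exact (hnn hu ω hω).1
    · exact (hnn hu ω hω).2
    · exact (hnn hv ω hω).1
    · exact (hnn hv ω hω).2
  obtain ⟨x, hx, y, hy, hxy⟩ := hu.exists_eval_eq hum hω
  obtain ⟨x', hx', y', hy', hxy'⟩ := hv.exists_eval_eq hvm hω
  have hmem : (![x, y, x', y'] : Fin 4 → ℝ) ∈ Set.Icc (0 : Fin 4 → ℝ) 1 := by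
    constructor <;> intro k <;> fin_cases k
    exacts [hx.1, hy.1, hx'.1, hy'.1, hx.2, hy.2, hx'.2, hy'.2]
  have key := eval_zonotopePoly_ne_zero_of_vertices_isHurwitz
    (p₀ := C a * Ku 0 + C b * Kv 0) (τ := τ) hT hε hTpos hd
    (fun x hx => by
      rw [hz]
      exact hdeg _ (hu.rectPoly_mem ⟨hx.1 0, hx.2 0⟩ ⟨hx.1 1, hx.2 1⟩)
        _ (hv.rectPoly_mem ⟨hx.1 2, hx.2 2⟩ ⟨hx.1 3, hx.2 3⟩))
    (fun x hx => by
      rw [hz]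
      obtain ⟨i, hi⟩ := hu.exists_eq_rectPoly (hx 0) (hx 1)
      obtain ⟨j, hj⟩ := hv.exists_eq_rectPoly (hx 2) (hx 3)
      rw [hi, hj]
      exact hvert i j) hmem hω
  rw [hz] at key
  rw [eval_add, eval_mul, eval_mul, hxy, hxy', ← eval_mul, ← eval_mul, ← eval_add]
  exact key

/-- Kharitonov's criterion for the combinations of two complex interval families with fixed complex
coefficients. -/
theorem isHurwitz_linearCombination
    (hdeg : ∀ u ∈ Du.family, ∀ v ∈ Dv.family, (C a * u + C b * v).degree = d)
    (hplus : ∀ i j, IsHurwitz (C a * Du.kPlus i + C b * Dv.kPlus j))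
    (hminus : ∀ i j, IsHurwitz (C a * Du.kMinus i + C b * Dv.kMinus j)) {u v : ℂ[X]}
    (hu : u ∈ Du.family) (hv : v ∈ Dv.family) : IsHurwitz (C a * u + C b * v) := by
  -- Phase strictly increases only in positive degree; in degree zero the members are nonzero
  -- constants, without roots.
  rcases Nat.eq_zero_or_pos d with rfl | hd
  · intro z hz
    rw [eq_C_of_degree_eq_zero (hdeg u hu v hv), IsRoot.def, eval_C] at hz
    exact absurd hz (coeff_ne_zero_of_eq_degree (hdeg u hu v hv))
  have haxis : ∀ u ∈ Du.family, ∀ v ∈ Dv.family, ∀ z : ℂ, z.re = 0 →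
      ¬ (C a * u + C b * v).IsRoot z := by
    intro u hu v hv z hz hroot
    have hzI : z = (z.im : ℝ) * Complex.I := Complex.ext (by simp [hz]) (by simp)
    rcases le_total 0 z.im with h | h
    · refine Du.isRectangle_kPlus.eval_linearCombination_ne_zero Dv.isRectangle_kPlus one_ne_zero hd
        hdeg hplus hu hv h ?_
      rwa [one_mul, ← hzI]
    · refine Du.isRectangle_kMinus.eval_linearCombination_ne_zero Dv.isRectangle_kMinus
        (neg_ne_zero.2 one_ne_zero) hd hdeg hminus hu hv (neg_nonneg.2 h) ?_
      rwa [neg_mul_neg, one_mul, ← hzI]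
  set p := C a * Du.kPlus 0 + C b * Dv.kPlus 0 with hp
  have hseg : ∀ t ∈ Set.Icc (0 : ℝ) 1, ∃ u' ∈ Du.family, ∃ v' ∈ Dv.family,
      p + C (t : ℂ) * (C a * u + C b * v - p) = C a * u' + C b * v' := by
    intro t ht
    refine ⟨_, Du.convex_family (Du.isRectangle_kPlus.mem 0) hu (sub_nonneg.2 ht.2) ht.1 (by ring),
      _, Dv.convex_family (Dv.isRectangle_kPlus.mem 0) hv (sub_nonneg.2 ht.2) ht.1 (by ring), ?_⟩
    ext i
    simp [hp]
    ring
  have := IsHurwitz.of_segment (p := p) (q := C a * u + C b * v - p) (d := d)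
    (fun t ht => by
      obtain ⟨u', hu', v', hv', h⟩ := hseg t ht
      rw [h]; exact hdeg u' hu' v' hv')
    (fun t ht z hz => by
      obtain ⟨u', hu', v', hv', h⟩ := hseg t ht
      rw [h]; exact haxis u' hu' v' hv' z hz) (hplus 0 0)
  rwa [add_sub_cancel] at this

end ComplexInterval

/-! ### Factorisation of the determinant and degrees of its factors. -/

/-- The determinant of a linear matrix pencil is a product of linear forms. -/
theorem exists_det_pencil_eq_prod {n : ℕ} (γ η : Matrix (Fin n) (Fin n) ℂ) :
    ∃ (c : ℂ) (L : Multiset (ℂ × ℂ)), ∀ x y : ℂ,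
      (x • γ + y • η).det = c * (L.map fun r => r.1 * x + r.2 * y).prod := by
  set f : ℂ[X] := ((X : ℂ[X]) • γ.map C + η.map C).det with hf
  have heval : ∀ x, f.eval x = (x • γ + η).det := by
    intro x
    rw [hf, ← coe_evalRingHom, RingHom.map_det]
    congr 1
    ext i j
    simp
    exact mul_comm _ _
  have hcard : f.roots.card ≤ n := by
    refine (card_roots' f).trans ?_
    simpa using natDegree_det_X_add_C_le γ η
  have hcoeff : f.coeff n = γ.det := by simpa using coeff_det_X_add_C_card γ η
  have hsplit := IsAlgClosed.splits f
  -- The forms `(0, 1)`, equal to `y`, are the roots at infinity: they make up for the degree that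
  -- `f` lacks when `γ` is singular.
  refine ⟨f.leadingCoeff,
    f.roots.map (fun r => (1, -r)) + Multiset.replicate (n - f.roots.card) (0, 1), fun x y => ?_⟩
  rw [Multiset.map_add, Multiset.prod_add, Multiset.map_map, Multiset.map_replicate,
    Multiset.prod_replicate]
  simp only [Function.comp_apply, one_mul, zero_mul, zero_add, neg_mul, ← sub_eq_add_neg]
  rcases eq_or_ne y 0 with rfl | hy
  · simp only [zero_smul, add_zero, mul_zero, sub_zero, Multiset.map_const',
      Multiset.prod_replicate, Matrix.det_smul, Fintype.card_fin]
    rw [← hcoeff]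
    rcases hcard.eq_or_lt with h | h
    · rw [h, Nat.sub_self, pow_zero, mul_one, mul_comm, leadingCoeff,
        hsplit.natDegree_eq_card_roots, h]
    · rw [zero_pow (Nat.sub_ne_zero_of_lt h), coeff_eq_zero_of_natDegree_lt
        (hsplit.natDegree_eq_card_roots.trans_lt h)]
      simp
  · have h1 : x • γ + y • η = y • ((x / y) • γ + η) := by
      rw [smul_add, smul_smul, mul_div_cancel₀ _ hy]
    have h2 : (f.roots.map fun r => x - r * y).prod =
        y ^ f.roots.card * (f.roots.map fun r => x / y - r).prod := by
      rw [← Multiset.card_map (fun r => x / y - r) f.roots, ← Multiset.prod_replicate,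
        ← Multiset.map_const', Multiset.map_map, ← Multiset.prod_map_mul]
      refine congrArg Multiset.prod (Multiset.map_congr rfl fun r _ => ?_)
      simp only [Function.comp_apply]
      field_simp
    rw [h1, Matrix.det_smul, ← heval, hsplit.eval_eq_prod_roots, h2, Fintype.card_fin]
    nth_rewrite 1 [← Nat.add_sub_cancel' hcard]
    rw [pow_add]
    ring

theorem exists_det_polyMatrix_eq_prod {n : ℕ} (γ η : Matrix (Fin n) (Fin n) ℂ) :
    ∃ (c : ℂ) (L : Multiset (ℂ × ℂ)), ∀ u v : ℂ[X],
      (polyMatrix γ η u v).det = C c * (L.map fun r : ℂ × ℂ => C r.1 * u + C r.2 * v).prod := by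
  obtain ⟨c, L, h⟩ := exists_det_pencil_eq_prod γ η
  refine ⟨c, L, fun u v => Polynomial.funext fun z => ?_⟩
  have h1 : (polyMatrix γ η u v).det.eval z = (u.eval z • γ + v.eval z • η).det := by
    rw [← coe_evalRingHom, RingHom.map_det]
    congr 1
    ext i j
    simp [polyMatrix, mul_comm]
  rw [h1, h, eval_mul, eval_C, eval_multiset_prod, Multiset.map_map]
  simp

/-- If a product of linear combinations has constant degree on a convex set of arguments, then so
does every factor. -/
theorem natDegree_factor_le_of_natDegree_prod_eq {U V : Set ℂ[X]} (hU : Convex ℝ U)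
    (hV : Convex ℝ V) {L : Multiset (ℂ × ℂ)} {d : ℕ}
    (hne : ∀ r ∈ L, ∀ u ∈ U, ∀ v ∈ V, C r.1 * u + C r.2 * v ≠ 0)
    (hdeg : ∀ u ∈ U, ∀ v ∈ V, (L.map fun r : ℂ × ℂ => C r.1 * u + C r.2 * v).prod.natDegree = d)
    {r : ℂ × ℂ} (hr : r ∈ L) {u v u' v' : ℂ[X]} (hu : u ∈ U) (hv : v ∈ V) (hu' : u' ∈ U)
    (hv' : v' ∈ V) : (C r.1 * u' + C r.2 * v').natDegree ≤ (C r.1 * u + C r.2 * v).natDegree := by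
  by_contra! hlt
  have hsum : ∀ u ∈ U, ∀ v ∈ V,
      (L.map fun r : ℂ × ℂ => (C r.1 * u + C r.2 * v).natDegree).sum = d := by
    intro u hu v hv
    rw [← hdeg u hu v hv, natDegree_multiset_prod, Multiset.map_map]
    · rfl
    · rw [Multiset.mem_map]
      rintro ⟨s, hs, h⟩
      exact hne s hs u hu v hv h
  let D : ℂ × ℂ → ℕ := fun s =>
    max (C s.1 * u + C s.2 * v).natDegree (C s.1 * u' + C s.2 * v').natDegree
  -- A parameter is bad for `s` if the factor loses the larger of its two end degrees there. Two bad
  -- parameters would kill that coefficient at both ends, although it leads at one of them.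
  let bad : ℂ × ℂ → Set ℝ := fun s => {t |
    ((1 - t : ℝ) : ℂ) * (C s.1 * u + C s.2 * v).coeff (D s) +
      (t : ℂ) * (C s.1 * u' + C s.2 * v').coeff (D s) = 0}
  have hbad : ∀ s ∈ L, (bad s).Finite := by
    intro s hs
    refine Set.Subsingleton.finite fun t ht t' ht' => ?_
    by_contra htt
    have htt' : (t : ℂ) - t' ≠ 0 := sub_ne_zero.2 (by exact_mod_cast htt)
    have ht : ((1 - t : ℝ) : ℂ) * (C s.1 * u + C s.2 * v).coeff (D s) +
      (t : ℂ) * (C s.1 * u' + C s.2 * v').coeff (D s) = 0 := ht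
    have ht' : ((1 - t' : ℝ) : ℂ) * (C s.1 * u + C s.2 * v).coeff (D s) +
      (t' : ℂ) * (C s.1 * u' + C s.2 * v').coeff (D s) = 0 := ht'
    push_cast at ht ht'
    have h1 : (C s.1 * u + C s.2 * v).coeff (D s) = (C s.1 * u' + C s.2 * v').coeff (D s) := by
      refine mul_left_cancel₀ htt' ?_
      linear_combination ht' - ht
    have h2 : (C s.1 * u + C s.2 * v).coeff (D s) = 0 := by
      linear_combination ht + (t : ℂ) * h1
    rcases max_choice (C s.1 * u + C s.2 * v).natDegree
      (C s.1 * u' + C s.2 * v').natDegree with h | h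
    · have : D s = _ := h
      rw [this] at h2
      exact hne s hs u hu v hv (leadingCoeff_eq_zero.1 h2)
    · have : D s = _ := h
      rw [h1, this] at h2
      exact hne s hs u' hu' v' hv' (leadingCoeff_eq_zero.1 h2)
  have hfin : (⋃ s ∈ {s | s ∈ L}, bad s).Finite := by
    refine Set.Finite.biUnion ?_ hbad
    classical
    exact (Multiset.finite_toSet L)
  -- At a parameter good for all factors, each degree is at least its value at `(u, v)` and the one
  -- of `r` is strictly larger, so the sum cannot remain `d`.
  obtain ⟨t, ht, htbad⟩ :=
    (Set.Icc_infinite (zero_lt_one' ℝ)).exists_notMem_finite hfin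
  have hU' := hU hu hu' (sub_nonneg.2 ht.2) ht.1 (by ring)
  have hV' := hV hv hv' (sub_nonneg.2 ht.2) ht.1 (by ring)
  have hD : ∀ s ∈ L, D s ≤
      (C s.1 * ((1 - t) • u + t • u') + C s.2 * ((1 - t) • v + t • v')).natDegree := by
    intro s hs
    refine le_natDegree_of_ne_zero fun h => htbad ?_
    refine Set.mem_biUnion (x := s) hs ?_
    change ((1 - t : ℝ) : ℂ) * (C s.1 * u + C s.2 * v).coeff (D s) +
      (t : ℂ) * (C s.1 * u' + C s.2 * v').coeff (D s) = 0
    rw [← h]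
    simp
    ring
  have h := Multiset.sum_lt_sum
    (f := fun s : ℂ × ℂ => (C s.1 * u + C s.2 * v).natDegree)
    (g := fun s : ℂ × ℂ =>
      (C s.1 * ((1 - t) • u + t • u') + C s.2 * ((1 - t) • v + t • v')).natDegree)
    (s := L) (fun s hs => (le_max_left _ _).trans (hD s hs))
    ⟨r, hr, (hlt.trans_le (le_max_right _ _)).trans_le (hD r hr)⟩
  rw [hsum u hu v hv, hsum _ hU' _ hV'] at h
  exact lt_irrefl _ h

/-! ### The criterion for determinants. -/

theorem theorem4 {n : ℕ} (γ η : Matrix (Fin n) (Fin n) ℂ) (Du Dv : ComplexInterval)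
    (hfix : HasFixedOrder (detFamily γ η Du Dv)) :
    detFamily γ η Du Dv ⊆ {p | IsHurwitz p} ↔
      {p | ∃ i j : Fin 4, p = (polyMatrix γ η (Du.kPlus i) (Dv.kPlus j)).det} ∪
        {p | ∃ i j : Fin 4, p = (polyMatrix γ η (Du.kMinus i) (Dv.kMinus j)).det} ⊆
        {p | IsHurwitz p} := by
  constructor
  · rintro h p (⟨i, j, rfl⟩ | ⟨i, j, rfl⟩)
    · exact h ⟨_, Du.isRectangle_kPlus.mem i, _, Dv.isRectangle_kPlus.mem j, rfl⟩
    · exact h ⟨_, Du.isRectangle_kMinus.mem i, _, Dv.isRectangle_kMinus.mem j, rfl⟩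
  intro h
  have hplus : ∀ i j, IsHurwitz (polyMatrix γ η (Du.kPlus i) (Dv.kPlus j)).det :=
    fun i j => h (Or.inl ⟨i, j, rfl⟩)
  have hminus : ∀ i j, IsHurwitz (polyMatrix γ η (Du.kMinus i) (Dv.kMinus j)).det :=
    fun i j => h (Or.inr ⟨i, j, rfl⟩)
  obtain ⟨c, L, hdet⟩ := exists_det_polyMatrix_eq_prod γ η
  have hmem0 := Du.isRectangle_kPlus.mem 0
  have hmem0' := Dv.isRectangle_kPlus.mem 0
  obtain ⟨d, hd⟩ := hfix
  have hdeg : ∀ u ∈ Du.family, ∀ v ∈ Dv.family, (polyMatrix γ η u v).det.degree = d :=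
    fun u hu v hv => hd _ ⟨u, hu, v, hv, rfl⟩
  -- One stable vertex is nonzero, so the common degree is not `⊥` and no member, hence no factor,
  -- vanishes identically.
  have hne0 : (polyMatrix γ η (Du.kPlus 0) (Dv.kPlus 0)).det ≠ 0 := by
    intro h0
    have := hplus 0 0 0 (by rw [h0]; exact eval_zero)
    simp at this
  have hne : ∀ u ∈ Du.family, ∀ v ∈ Dv.family, (polyMatrix γ η u v).det ≠ 0 := by
    intro u hu v hv h0
    have := (hdeg _ hmem0 _ hmem0').trans (hdeg u hu v hv).symm
    rw [h0, degree_zero, degree_eq_bot] at this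
    exact hne0 this
  have hc : c ≠ 0 := by
    rintro rfl
    exact hne0 (by rw [hdet]; simp)
  have hfac : ∀ r ∈ L, ∀ u ∈ Du.family, ∀ v ∈ Dv.family, C r.1 * u + C r.2 * v ≠ 0 := by
    intro r hr u hu v hv h0
    refine hne u hu v hv ?_
    rw [hdet, Multiset.prod_eq_zero (Multiset.mem_map.2 ⟨r, hr, h0⟩), mul_zero]
  have hroot : ∀ u v : ℂ[X], IsHurwitz (polyMatrix γ η u v).det → ∀ r ∈ L,
      IsHurwitz (C r.1 * u + C r.2 * v) := by
    intro u v hH r hr z hz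
    refine hH z ?_
    rw [hdet]
    exact hz.dvd ((Multiset.dvd_prod (Multiset.mem_map.2 ⟨r, hr, rfl⟩)).mul_left _)
  have hnat : ∀ u ∈ Du.family, ∀ v ∈ Dv.family,
      (L.map fun r : ℂ × ℂ => C r.1 * u + C r.2 * v).prod.natDegree =
        (polyMatrix γ η (Du.kPlus 0) (Dv.kPlus 0)).det.natDegree := by
    intro u hu v hv
    rw [← natDegree_C_mul hc, ← hdet]
    exact natDegree_eq_of_degree_eq ((hdeg u hu v hv).trans (hdeg _ hmem0 _ hmem0').symm)
  rintro _ ⟨u, hu, v, hv, rfl⟩ z hz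
  rw [hdet, IsRoot.def, eval_mul, eval_C, mul_eq_zero, or_iff_right hc, eval_multiset_prod,
    Multiset.prod_eq_zero_iff, Multiset.map_map, Multiset.mem_map] at hz
  obtain ⟨r, hr, hz⟩ := hz
  refine ComplexInterval.isHurwitz_linearCombination
    (d := (C r.1 * u + C r.2 * v).natDegree) (fun u' hu' v' hv' => ?_)
    (fun i j => hroot _ _ (hplus i j) r hr) (fun i j => hroot _ _ (hminus i j) r hr) hu hv z hz
  rw [degree_eq_natDegree (hfac r hr u' hu' v' hv')]
  exact congrArg _ (le_antisymm
    (natDegree_factor_le_of_natDegree_prod_eq Du.convex_family Dv.convex_family hfac hnat hr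
      hu hv hu' hv')
    (natDegree_factor_le_of_natDegree_prod_eq Du.convex_family Dv.convex_family hfac hnat hr
      hu' hv' hu hv))
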